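/- Let $d\ge 1$ and let $n_1,\dots,n_d$ be positive integers, each of which is either $2$ or a multiple of $4$. Put $G=\prod_{i=1}^d \mathbb Z/n_i\mathbb Z$, and let $\delta$ be the Lee distance on $G$, i.e. the shortest-path distance in the graph on $G$ in which two distinct elements are adjacent when they differ by $\pm1$ in one coordinate and agree in all the others. Let $f:(0,\infty)\to(0,\infty)$ be strictly completely monotonic: $f$ is $C^\infty$ and $(-1)^k f^{(k)}(x)>0$ for all $x>0$ and all integers $k\ge 0$. For $g\ne h$ in $G$ put $u(g,h)=f(\delta(g,h))$. For $S\subseteq G$ and $h\in S$ let $E_h(S)=\sum_{g\in S\setminus\{h\}}u(h,g)$; let $E_{\mathrm{tot}}(S)=\sum_{h\in S}E_h(S)$ be the total energy and, for nonempty $S$, let $E_{\max}(S)=\max_{h\in S}E_h(S)$ be the maximal energy. On $V=\mathbb R^G$ let $(x|y)=\sum_{g\in G}x(g)y(g)$, let $\mathbf 1$ be the all-one vector, and let $A:V\to V$ be the linear map $(Ax)(h)=\sum_{g\ne 0}u(g,0)\,x(h-g)$. Let $$S_{\mathrm{even}}=\{(j_1,\dots,j_d)\in G : \textstyle\sum_i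 j_i \text{ is even}\},\qquad S_{\mathrm{odd}}=\{(j_1,\dots,j_d)\in G : \textstyle\sum_i j_i \text{ is odd}\}$$ be the two checkerboard configurations (well defined since all $n_i$ are even). Then: 1. The minimisers of the fractional energy $(x|Ax)$ over all $x\in V$ with $(x|x)=(x|\mathbf 1)=|G|/2$ are exactly the characteristic vectors of $S_{\mathrm{even}}$ and $S_{\mathrm{odd}}$. 2. The minimisers of the total energy $E_{\mathrm{tot}}(S)$ over all subsets $S\subseteq G$ with $|S|=|G|/2$ are exactly $S_{\mathrm{even}}$ and $S_{\mathrm{odd}}$. 3. The minimisers of the maximal energy $E_{\max}(S)$ over all subsets $S\subseteq G$ with $|S|=|G|/2$ are exactly $S_{\mathrm{even}}$ and $S_{\mathrm{odd}}$. 4. For every character $\chi$ of $G$ (group homomorphism from $G$ to the multiplicative group of $\mathbb C$), the number $\lambda(\chi)=\sum_{g\ne 0}f(\delta(g,0))\,\chi(g)$ is real, and $\lambda$ attains its minimum over the characters of $G$ at exactly one character, namely the one that takes the value $-1$ on each of the standard generators $(1,0,\dots,0),\dots,(0,\dots,0,1)$ of $G$. -/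

import Mathlib

open scoped ContDiff

namespace ToricGrid

/-- `f` is strictly completely monotonic on the positive reals: it is smooth there and
`(-1)^k f^(k)(x) > 0` for all `x > 0` and all `k ≥ 0`. -/
def StrictlyCompletelyMonotonic (f : ℝ → ℝ) : Prop :=
  ContDiffOn ℝ ∞ f (Set.Ioi 0) ∧
    ∀ k : ℕ, ∀ x : ℝ, 0 < x → 0 < (-1) ^ k * iteratedDerivWithin k f (Set.Ioi 0) x

/-- The set of minimisers of the objective `F` over the feasible set `C`. -/
def minimisers {α : Type*} (F : α → ℝ) (C : Set α) : Set α :=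
  {x | x ∈ C ∧ ∀ y ∈ C, F x ≤ F y}

section Energy

/-- The energy of `S` experienced by `h`. -/
def energyAt {G : Type*} [DecidableEq G] (u : G → G → ℝ) (S : Finset G) (h : G) : ℝ :=
  ∑ g ∈ S.erase h, u h g

/-- The total energy of `S`. -/
def totalEnergy {G : Type*} [DecidableEq G] (u : G → G → ℝ) (S : Finset G) : ℝ :=
  ∑ h ∈ S, energyAt u S h

/-- The maximal energy of `S`: the supremum is over a finite set, hence is a maximum when `S` is
nonempty. -/
noncomputable def maxEnergy {G : Type*} [DecidableEq G] (u : G → G → ℝ) (S : Finset G) : ℝ :=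
  ⨆ h : {h : G // h ∈ S}, energyAt u S h.1

/-- The energy kernel `A = ∑_{g ≠ 0} u(g,0) g` of the group algebra, acting on `ℝ^G`, where `g` acts
by `(g x)(h) = x (h - g)`. -/
noncomputable def energyKernel {G : Type*} [AddCommGroup G] [Fintype G] [DecidableEq G]
    (u : G → G → ℝ) : (G → ℝ) →ₗ[ℝ] (G → ℝ) where
  toFun x h := ∑ g ∈ Finset.univ.erase 0, u g 0 * x (h - g)
  map_add' x y := by
    funext h
    simp [mul_add, Finset.sum_add_distrib]
  map_smul' c x := by
    funext h
    simp only [Pi.smul_apply, smul_eq_mul, RingHom.id_apply, Finset.mul_sum]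
    exact Finset.sum_congr rfl fun g _ => by ring

/-- The fractional energy `(x|Ax)`. -/
noncomputable def fractionalEnergy {G : Type*} [AddCommGroup G] [Fintype G] [DecidableEq G]
    (u : G → G → ℝ) (x : G → ℝ) : ℝ :=
  x ⬝ᵥ energyKernel u x

/-- The characteristic vector of `S`. -/
def charVec {G : Type*} [DecidableEq G] (S : Finset G) : G → ℝ :=
  fun g => if g ∈ S then 1 else 0

/-- The Fourier transform `∑_{g ≠ 0} u(g,0) χ(g)` at the character `χ`. -/
noncomputable def eigenvalue {G : Type*} [AddCommGroup G] [Fintype G] [DecidableEq G]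
    (u : G → G → ℝ) (χ : AddChar G ℂ) : ℂ :=
  ∑ g ∈ Finset.univ.erase 0, (u g 0 : ℂ) * χ g

end Energy

/-- The group `∏ ℤ/n_i`. -/
abbrev Grid {d : ℕ} (n : Fin d → ℕ) : Type := (i : Fin d) → ZMod (n i)

/-- The graph on `∏ ℤ/n_i` joining distinct elements that differ by `±1` in one coordinate and
agree in all the others. -/
def gridGraph {d : ℕ} (n : Fin d → ℕ) : SimpleGraph (Grid n) :=
  SimpleGraph.fromRel fun g h => ∃ i : Fin d, h - g = Pi.single i 1

/-- The Lee distance: the shortest-path distance in the grid graph. -/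
noncomputable def leeDist {d : ℕ} (n : Fin d → ℕ) (g h : Grid n) : ℕ :=
  (gridGraph n).dist g h

/-- The interaction `u(g,h) = f(δ(g,h))`, with `δ` the Lee distance (only its values for `g ≠ h`
are ever used). -/
noncomputable def interaction {d : ℕ} (n : Fin d → ℕ) (f : ℝ → ℝ) (g h : Grid n) : ℝ :=
  f (leeDist n g h)

/-- The checkerboard configuration of elements with even coordinate sum. -/
def evenBoard {d : ℕ} (n : Fin d → ℕ) [∀ i, NeZero (n i)] : Finset (Grid n) :=
  Finset.univ.filter fun g => Even (∑ i, (g i).val)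

/-- The checkerboard configuration of elements with odd coordinate sum. -/
def oddBoard {d : ℕ} (n : Fin d → ℕ) [∀ i, NeZero (n i)] : Finset (Grid n) :=
  Finset.univ.filter fun g => Odd (∑ i, (g i).val)

end ToricGrid

set_option linter.unusedSectionVars false

/-! ### Moment functionals and complete monotonicity -/

section Moments

open Polynomial Filter Topology

/-! The kernel is translation invariant, so characters diagonalise it. The two constraints fix the
Fourier coefficient of `x` at the trivial character and the total mass of the others. The energy is
therefore least exactly when that remaining mass sits on the characters with the smallest
eigenvalue. If this is only the sign character, `x` is `1/2 + c * σ` with `σ = ±1` the checkerboard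
sign, and the norm forces `c = ±1/2`: these are the two boards (`minimisers_eq`). Total energy is
fractional energy at characteristic vectors. Maximal energy is at least the average, with equality
on the boards, whose points all have the same energy.

It remains to compare eigenvalues. For the weight `r ^ δ` with `0 < r < 1`, the character sum
factors over coordinates. On a cycle of length `2m` each factor is the Poisson-type quotient `(1 -
r²)(1 - zᵐrᵐ) / |1 - rz|²`, where `z` is the character's value at `1`. For even `m`, `z = -1`
minimises the numerator and is the unique maximiser of the denominator (`leeSum_re_lt`); length 2 is
immediate.

Passing from powers to `f` is a discrete Hausdorff moment argument, without a representing measure.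
Iterated differences of `f` have strict signs, so the functional `X ^ k ↦ f (k + 1)` is positive on
each `X ^ a * (1 - X) ^ b`, hence, by Bernstein averages, on each polynomial positive on `(0,1)`
(`map_pos_of_eval_pos`). Strict inequalities for all `r` thus survive in
`StrictlyCompletelyMonotonic.sum_pos`. -/

theorem bernsteinPolynomial.sum_choose_smul (N k : ℕ) (hk : k ≤ N) :
    ∑ j ∈ Finset.range (N + 1), (j.choose k : ℝ) • bernsteinPolynomial ℝ N j =
      (N.choose k : ℝ) • (X : ℝ[X]) ^ k := by
  obtain ⟨M, rfl⟩ := Nat.exists_eq_add_of_le hk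
  rw [add_assoc, Finset.sum_range_add, Finset.sum_eq_zero, zero_add]
  · have h1 : (X : ℝ[X]) ^ k = ∑ i ∈ Finset.range (M + 1), X ^ k * bernsteinPolynomial ℝ M i := by
      rw [← Finset.mul_sum, bernsteinPolynomial.sum, mul_one]
    rw [h1, Finset.smul_sum]
    refine Finset.sum_congr rfl fun i hi => ?_
    have hi' : i ≤ M := by simpa [Nat.lt_succ_iff] using hi
    have h2 := Nat.choose_mul (n := k + M) (k := k + i) (s := k) (by omega)
    simp only [Nat.add_sub_cancel_left] at h2
    have h3 : ((k + M).choose (k + i) : ℝ[X]) * ((k + i).choose k : ℝ[X]) =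
        ((k + M).choose k : ℝ[X]) * (M.choose i : ℝ[X]) := by
      exact_mod_cast congrArg (Nat.cast (R := ℝ[X])) h2
    rw [bernsteinPolynomial, bernsteinPolynomial, Nat.add_sub_add_left, smul_eq_C_mul, smul_eq_C_mul,
      C_eq_natCast, C_eq_natCast, pow_add]
    linear_combination X ^ k * X ^ i * (1 - X) ^ (M - i) * h3
  · intro j hj
    rw [Nat.choose_eq_zero_of_lt (by simpa using hj)]
    simp

/-- The quotient is the product of `(j - i) / (N - i)` for `i < k`, each within `i / N` of `j / N`.
All factors lie in `[0,1]`, so the errors merely add up. -/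
theorem abs_choose_div_choose_sub_pow_le {N j k : ℕ} (hj : j ≤ N) (hk : k ≤ N) (hN : 0 < N) :
    |(j.choose k : ℝ) / N.choose k - ((j : ℝ) / N) ^ k| ≤ (k : ℝ) ^ 2 / N := by
  have hN' : (0 : ℝ) < N := by exact_mod_cast hN
  have key : ∀ k : ℕ, k ≤ N →
      |(j.descFactorial k : ℝ) / N.descFactorial k - ((j : ℝ) / N) ^ k| ≤ (k : ℝ) ^ 2 / N := by
    intro k
    induction k with
    | zero => intro _; simp
    | succ k ih =>
      intro hk
      have ih := ih (by omega)
      have hkN : (0 : ℝ) < (N - k : ℕ) := by exact_mod_cast (by omega : 0 < N - k)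
      have hd : (0 : ℝ) < N.descFactorial k := by
        exact_mod_cast Nat.pos_of_ne_zero (by rw [Ne, Nat.descFactorial_eq_zero_iff_lt]; omega)
      have hr : (j.descFactorial (k + 1) : ℝ) / N.descFactorial (k + 1) =
          ((j - k : ℕ) : ℝ) / (N - k : ℕ) * ((j.descFactorial k : ℝ) / N.descFactorial k) := by
        rw [Nat.descFactorial_succ, Nat.descFactorial_succ]
        push_cast
        field_simp
      have hx0 : (0 : ℝ) ≤ j / N := by positivity
      have hx1 : (j : ℝ) / N ≤ 1 := (div_le_one hN').2 (by exact_mod_cast hj)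
      have hy0 : (0 : ℝ) ≤ (j - k : ℕ) / (N - k : ℕ) := by positivity
      have hy1 : ((j - k : ℕ) : ℝ) / (N - k : ℕ) ≤ 1 :=
        (div_le_one hkN).2 (by exact_mod_cast Nat.sub_le_sub_right hj k)
      have hxy : |((j - k : ℕ) : ℝ) / (N - k : ℕ) - j / N| ≤ k / N := by
        have hjN : (j : ℝ) ≤ N := by exact_mod_cast hj
        rcases le_total k j with h | h
        · have hkN' : (0 : ℝ) < N - k := by rwa [Nat.cast_sub (by omega)] at hkN
          rw [Nat.cast_sub h, Nat.cast_sub (by omega)]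
          have : ((j : ℝ) - k) / (N - k) - j / N = -(k / N * ((N - j) / (N - k))) := by
            field_simp
            ring
          rw [this, abs_neg, abs_of_nonneg
            (mul_nonneg (by positivity) (div_nonneg (by linarith) hkN'.le))]
          refine mul_le_of_le_one_right (by positivity) ((div_le_one hkN').2 ?_)
          have : (k : ℝ) ≤ j := by exact_mod_cast h
          linarith
        · rw [Nat.sub_eq_zero_of_le h]
          simp only [Nat.cast_zero, zero_div, zero_sub, abs_neg]
          rw [abs_of_nonneg hx0]
          gcongr
      have hp1 : ((j : ℝ) / N) ^ k ≤ 1 := pow_le_one₀ hx0 hx1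
      have hp0 : 0 ≤ ((j : ℝ) / N) ^ k := by positivity
      rw [hr, pow_succ]
      generalize (j.descFactorial k : ℝ) / N.descFactorial k = a at *
      generalize ((j - k : ℕ) : ℝ) / (N - k : ℕ) = y at *
      generalize ((j : ℝ) / N) ^ k = b at *
      generalize (j : ℝ) / N = x at *
      have : y * a - b * x = y * (a - b) + b * (y - x) := by ring
      calc |y * a - b * x| ≤ |y| * |a - b| + |b| * |y - x| := by
            rw [this, ← abs_mul, ← abs_mul]; exact abs_add_le _ _
        _ ≤ 1 * ((k : ℝ) ^ 2 / N) + 1 * (k / N) := by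
            rw [abs_of_nonneg hy0, abs_of_nonneg hp0]
            gcongr
        _ ≤ ((k + 1 : ℕ) : ℝ) ^ 2 / N := by
            rw [one_mul, one_mul, ← add_div]
            gcongr
            push_cast
            nlinarith [(Nat.cast_nonneg k : (0 : ℝ) ≤ k)]
  have h := key k hk
  rw [Nat.descFactorial_eq_factorial_mul_choose, Nat.descFactorial_eq_factorial_mul_choose] at h
  push_cast at h
  rwa [mul_div_mul_left _ _ (by positivity)] at h

/-- A functional on polynomials that is positive on the Bernstein basis is a limit of its discrete
Bernstein averages. -/
theorem tendsto_sum_bernsteinPolynomial_mul_eval (L : ℝ[X] →ₗ[ℝ] ℝ)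
    (H : ∀ a b : ℕ, 0 < L (X ^ a * (1 - X) ^ b)) (Q : ℝ[X]) :
    Tendsto (fun N : ℕ => ∑ j ∈ Finset.range (N + 1),
      L (bernsteinPolynomial ℝ N j) * Q.eval ((j : ℝ) / N)) atTop (𝓝 (L Q)) := by
  have hw : ∀ N j, 0 ≤ L (bernsteinPolynomial ℝ N j) := by
    intro N j
    rw [bernsteinPolynomial, mul_assoc, ← C_eq_natCast, ← smul_eq_C_mul, map_smul]
    exact mul_nonneg (by positivity) (H _ _).le
  have hsum : ∀ N, ∑ j ∈ Finset.range (N + 1), L (bernsteinPolynomial ℝ N j) = L 1 := by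
    intro N
    rw [← map_sum, bernsteinPolynomial.sum]
  induction Q using Polynomial.induction_on' with
  | add p q hp hq =>
    simpa only [eval_add, mul_add, Finset.sum_add_distrib, map_add] using hp.add hq
  | monomial k c =>
    have hX : Tendsto (fun N : ℕ => ∑ j ∈ Finset.range (N + 1),
        L (bernsteinPolynomial ℝ N j) * ((j : ℝ) / N) ^ k) atTop (𝓝 (L (X ^ k))) := by
      rw [tendsto_iff_dist_tendsto_zero]
      have hlim : Tendsto (fun N : ℕ => L 1 * ((k : ℝ) ^ 2 / N)) atTop (𝓝 0) := by
        simpa using (tendsto_const_div_atTop_nhds_zero_nat ((k : ℝ) ^ 2)).const_mul (L 1)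
      refine squeeze_zero' (Eventually.of_forall fun _ => dist_nonneg) ?_ hlim
      filter_upwards [eventually_ge_atTop (k + 1)] with N hN
      have hc : (0 : ℝ) < N.choose k := by exact_mod_cast Nat.choose_pos (by omega)
      -- The binomial quotients give `L (X ^ k)` exactly; only replacing them by `(j / N) ^ k` costs
      -- an error, of order `1 / N`.
      have hLX : L (X ^ k) = ∑ j ∈ Finset.range (N + 1),
          L (bernsteinPolynomial ℝ N j) * ((j.choose k : ℝ) / N.choose k) := by
        have h := congrArg L (bernsteinPolynomial.sum_choose_smul N k (by omega))
        simp only [map_sum, map_smul, smul_eq_mul] at h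
        rw [← mul_right_inj' hc.ne', ← h, Finset.mul_sum]
        refine Finset.sum_congr rfl fun j _ => ?_
        field_simp
      rw [dist_comm, Real.dist_eq, hLX, ← Finset.sum_sub_distrib, ← hsum N, Finset.sum_mul]
      refine (Finset.abs_sum_le_sum_abs _ _).trans (Finset.sum_le_sum fun j hj => ?_)
      rw [← mul_sub, abs_mul, abs_of_nonneg (hw N j)]
      exact mul_le_mul_of_nonneg_left (abs_choose_div_choose_sub_pow_le
        (by simpa [Nat.lt_succ_iff] using hj) (by omega) (by omega)) (hw N j)
    have := hX.const_mul c
    rw [← smul_X_eq_monomial, map_smul, smul_eq_mul]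
    refine this.congr fun N => ?_
    rw [Finset.mul_sum]
    refine Finset.sum_congr rfl fun j _ => ?_
    simp only [eval_smul, eval_pow, eval_X, smul_eq_mul]
    ring

/-- Each Bernstein average has nonnegative weights of total mass `L 1` and samples `Q` only in
`[0,1]`; the bound passes to the limit. -/
theorem const_mul_map_one_le_of_forall_le_eval (L : ℝ[X] →ₗ[ℝ] ℝ)
    (H : ∀ a b : ℕ, 0 < L (X ^ a * (1 - X) ^ b)) (Q : ℝ[X]) (ε : ℝ)
    (hQ : ∀ t ∈ Set.Icc (0 : ℝ) 1, ε ≤ Q.eval t) : ε * L 1 ≤ L Q := by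
  refine ge_of_tendsto (tendsto_sum_bernsteinPolynomial_mul_eval L H Q) (Eventually.of_forall ?_)
  intro N
  have hsum : ∑ j ∈ Finset.range (N + 1), L (bernsteinPolynomial ℝ N j) = L 1 := by
    rw [← map_sum, bernsteinPolynomial.sum]
  rw [← hsum, Finset.mul_sum]
  refine Finset.sum_le_sum fun j hj => ?_
  rw [mul_comm]
  refine mul_le_mul_of_nonneg_left (hQ _ ⟨by positivity, ?_⟩) ?_
  · exact div_le_one_of_le₀ (by exact_mod_cast (by simpa [Nat.lt_succ_iff] using hj : j ≤ N))
      (by positivity)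
  · rw [bernsteinPolynomial, mul_assoc, ← C_eq_natCast, ← smul_eq_C_mul, map_smul]
    exact mul_nonneg (by positivity) (H _ _).le

/-- A linear functional that is positive on all `X ^ a * (1 - X) ^ b` is positive on every
polynomial that is positive on the open unit interval. -/
theorem map_pos_of_eval_pos (L : ℝ[X] →ₗ[ℝ] ℝ)
    (H : ∀ a b : ℕ, 0 < L (X ^ a * (1 - X) ^ b)) (P : ℝ[X])
    (hP : ∀ t ∈ Set.Ioo (0 : ℝ) 1, 0 < P.eval t) : 0 < L P := by
  have hP0 : P ≠ 0 := by
    rintro rfl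
    simpa using hP (1 / 2) ⟨by norm_num, by norm_num⟩
  obtain ⟨R, hR, hR0⟩ := exists_eq_pow_rootMultiplicity_mul_and_not_dvd P hP0 0
  have hRne : R ≠ 0 := by
    rintro rfl
    exact hR0 (dvd_zero _)
  obtain ⟨Q, hQ, hQ1⟩ := exists_eq_pow_rootMultiplicity_mul_and_not_dvd R hRne 1
  set a := rootMultiplicity 0 P
  set b := rootMultiplicity 1 R
  rw [dvd_iff_isRoot] at hR0 hQ1
  -- Splitting off the zeros at both endpoints leaves a factor with a positive minimum on the closed
  -- interval, which is what makes the final inequality strict.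
  obtain ⟨T, hT, hTpos⟩ : ∃ T : ℝ[X], P = X ^ a * (1 - X) ^ b * T ∧
      ∀ t ∈ Set.Icc (0 : ℝ) 1, 0 < T.eval t := by
    have hPT : P = X ^ a * (1 - X) ^ b * (C ((-1) ^ b) * Q) := by
      rw [hR, hQ, C_0, sub_zero, C_1, C_pow, C_neg, C_1]
      have : (X - 1 : ℝ[X]) ^ b = (1 - X) ^ b * (-1) ^ b := by
        rw [← mul_pow]; ring_nf
      rw [this]; ring
    refine ⟨_, hPT, ?_⟩
    set T := C ((-1) ^ b) * Q
    have hTo : ∀ t ∈ Set.Ioo (0 : ℝ) 1, 0 < T.eval t := by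
      intro t ht
      have h := hP t ht
      rw [hPT] at h
      simp only [eval_mul, eval_pow, eval_X, eval_sub, eval_one] at h
      exact pos_of_mul_pos_right h (mul_nonneg (pow_nonneg ht.1.le _)
        (pow_nonneg (sub_nonneg.2 ht.2.le) _))
    have hTc : ∀ t ∈ Set.Icc (0 : ℝ) 1, 0 ≤ T.eval t := by
      have hcl : IsClosed {t : ℝ | 0 ≤ T.eval t} := isClosed_le continuous_const T.continuous
      rw [← closure_Ioo (zero_ne_one : (0 : ℝ) ≠ 1)]
      exact hcl.closure_subset_iff.2 fun t ht => (hTo t ht).le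
    intro t ht
    refine lt_of_le_of_ne (hTc t ht) (Ne.symm ?_)
    have hs : ∀ t, Q.eval t ≠ 0 → T.eval t ≠ 0 := by
      intro t h
      simp only [T, eval_mul, eval_C]
      exact mul_ne_zero (pow_ne_zero _ (by norm_num)) h
    rcases eq_or_lt_of_le ht.1 with h0 | h0
    · refine hs t fun h => hR0 ?_
      subst h0
      rw [IsRoot, hQ, eval_mul, h, mul_zero]
    rcases eq_or_lt_of_le ht.2 with h1 | h1
    · exact hs t fun h => hQ1 (by rw [IsRoot, ← h1, h])
    · exact (hTo t ⟨h0, h1⟩).ne'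
  obtain ⟨t₀, ht₀, hmin⟩ := (isCompact_Icc (a := (0 : ℝ)) (b := 1)).exists_isMinOn
    ⟨0, by simp⟩ (T.continuous.continuousOn)
  -- The twisted functional inherits the positivity of `L`, because multiplication only raises the
  -- two exponents.
  let M : ℝ[X] →ₗ[ℝ] ℝ := L ∘ₗ LinearMap.mulLeft ℝ (X ^ a * (1 - X) ^ b)
  have hM : ∀ Q, M Q = L (X ^ a * (1 - X) ^ b * Q) := fun _ => rfl
  have h := const_mul_map_one_le_of_forall_le_eval M (fun a' b' => by
    rw [hM]
    convert H (a + a') (b + b') using 2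
    ring) T (T.eval t₀) (fun t ht => hmin ht)
  rw [hT, ← hM]
  refine lt_of_lt_of_le (mul_pos (hTpos t₀ ht₀) ?_) h
  rw [hM, mul_one]
  exact H a b

/-- The linear functional on polynomials with moments `s`. -/
noncomputable def momentFunctional (s : ℕ → ℝ) : ℝ[X] →ₗ[ℝ] ℝ :=
  Polynomial.lsum fun k => s k • LinearMap.id

theorem momentFunctional_monomial (s : ℕ → ℝ) (k : ℕ) (c : ℝ) :
    momentFunctional s (monomial k c) = c * s k := by
  simp [momentFunctional, Polynomial.lsum_apply, mul_comm]

theorem momentFunctional_mul_X (s : ℕ → ℝ) (P : ℝ[X]) :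
    momentFunctional s (P * X) = momentFunctional (fun k => s (k + 1)) P := by
  induction P using Polynomial.induction_on' with
  | add p q hp hq => rw [add_mul, map_add, map_add, hp, hq]
  | monomial k c => rw [monomial_mul_X, momentFunctional_monomial, momentFunctional_monomial]

theorem momentFunctional_mul_one_sub_X (s : ℕ → ℝ) (P : ℝ[X]) :
    momentFunctional s (P * (1 - X)) = momentFunctional (fun k => s k - s (k + 1)) P := by
  rw [mul_sub, mul_one, map_sub, momentFunctional_mul_X]
  induction P using Polynomial.induction_on' with
  | add p q hp hq => simp only [map_add]; rw [← hp, ← hq]; ring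
  | monomial k c => simp only [momentFunctional_monomial]; ring

/-- A factor `1 - X` replaces each `F k` by `F k x - F k (x + 1)`, which keeps the sign pattern
because `(-1) ^ k * F k` is strictly decreasing. Quantifying over the whole sequence `F` lets the
induction on `b` proceed. The shift `k + 1` keeps arguments positive. -/
theorem momentFunctional_pos_of_hasDerivAt (F : ℕ → ℝ → ℝ)
    (hd : ∀ k x, 0 < x → HasDerivAt (F k) (F (k + 1) x) x)
    (hp : ∀ k x, 0 < x → 0 < (-1) ^ k * F k x) (a b : ℕ) :
    0 < momentFunctional (fun k => F 0 (k + 1)) (X ^ a * (1 - X) ^ b) := by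
  induction b generalizing F with
  | zero =>
    have := momentFunctional_monomial (fun k => F 0 (k + 1)) a 1
    rw [monomial_one_right_eq_X_pow] at this
    rw [pow_zero, mul_one, this, one_mul]
    simpa using hp 0 (a + 1) (by positivity)
  | succ b ih =>
    rw [pow_succ, ← mul_assoc, momentFunctional_mul_one_sub_X]
    have h := ih (fun k x => F k x - F k (x + 1)) (fun k x hx =>
      (hd k x hx).sub ((hd k (x + 1) (by linarith)).comp_add_const x 1)) ?_
    · simpa using h
    · intro k x hx
      have hanti : StrictAntiOn (fun y => (-1) ^ k * F k y) (Set.Ioi 0) := by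
        have hdk : ∀ y, 0 < y → HasDerivAt (fun y => (-1) ^ k * F k y) ((-1) ^ k * F (k + 1) y) y :=
          fun y hy => (hd k y hy).const_mul _
        refine strictAntiOn_of_deriv_neg (convex_Ioi 0)
          (fun y hy => (hdk y hy).continuousAt.continuousWithinAt) fun y hy => ?_
        rw [interior_Ioi] at hy
        rw [(hdk y hy).deriv]
        have := hp (k + 1) y hy
        rw [pow_succ] at this
        linarith
      have := hanti (Set.mem_Ioi.2 hx) (Set.mem_Ioi.2 (by linarith : 0 < x + 1)) (lt_add_one x)
      simp only at this
      rw [mul_sub]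
      linarith

namespace ToricGrid

theorem StrictlyCompletelyMonotonic.momentFunctional_pos {f : ℝ → ℝ}
    (hf : StrictlyCompletelyMonotonic f) (a b : ℕ) :
    0 < momentFunctional (fun k => f (k + 1)) (X ^ a * (1 - X) ^ b) := by
  have h := momentFunctional_pos_of_hasDerivAt
    (fun k => iteratedDerivWithin k f (Set.Ioi 0)) ?_ hf.2 a b
  · simpa using h
  · intro k x hx
    have hdiff := hf.1.differentiableOn_iteratedDerivWithin (m := k)
      (by exact_mod_cast WithTop.coe_lt_top _) (uniqueDiffOn_Ioi 0)
    have h := ((hdiff x hx).hasDerivWithinAt).hasDerivAt (Ioi_mem_nhds hx)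
    rwa [← iteratedDerivWithin_succ] at h

/-- A polynomial with coefficients indexed by `s` that is positive on the open unit interval stays
positive when each power `r ^ e` is replaced by `f e`. -/
theorem StrictlyCompletelyMonotonic.sum_pos {f : ℝ → ℝ}
    (hf : StrictlyCompletelyMonotonic f) {ι : Type*} (s : Finset ι) (a : ι → ℝ) (e : ι → ℕ)
    (he : ∀ i ∈ s, e i ≠ 0) (h : ∀ r ∈ Set.Ioo (0 : ℝ) 1, 0 < ∑ i ∈ s, a i * r ^ e i) :
    0 < ∑ i ∈ s, a i * f (e i) := by
  -- Exponents drop by one because the `k`-th moment is `f (k + 1)`; the missing factor `t` is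
  -- positive, hence harmless.
  have h1 := map_pos_of_eval_pos _ hf.momentFunctional_pos (∑ i ∈ s, monomial (e i - 1) (a i)) ?_
  · rw [map_sum] at h1
    refine h1.trans_eq (Finset.sum_congr rfl fun i hi => ?_)
    rw [momentFunctional_monomial, ← Nat.cast_succ, Nat.succ_eq_add_one,
      Nat.sub_add_cancel (Nat.one_le_iff_ne_zero.2 (he i hi))]
  · intro t ht
    refine pos_of_mul_pos_left (b := t) ?_ ht.1.le
    rw [eval_finsetSum, Finset.sum_mul]
    refine (h t ht).trans_eq (Finset.sum_congr rfl fun i hi => ?_)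
    rw [eval_monomial, mul_assoc, ← pow_succ,
      Nat.sub_add_cancel (Nat.one_le_iff_ne_zero.2 (he i hi))]

end ToricGrid

end Moments

/-! ### Lee distance as a sum over coordinates -/

namespace ToricGrid

/-- The Lee norm on `∏ ℤ/n_i`. -/
def leeNorm {d : ℕ} {n : Fin d → ℕ} (x : Grid n) : ℕ :=
  ∑ i, (x i).valMinAbs.natAbs

theorem leeNorm_zero {d : ℕ} {n : Fin d → ℕ} : leeNorm (0 : Grid n) = 0 := by
  simp [leeNorm]

theorem leeNorm_neg {d : ℕ} {n : Fin d → ℕ} (x : Grid n) : leeNorm (-x) = leeNorm x := by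
  simp [leeNorm, ZMod.natAbs_valMinAbs_neg]

theorem leeNorm_eq_zero {d : ℕ} {n : Fin d → ℕ} {x : Grid n} : leeNorm x = 0 ↔ x = 0 := by
  simp [leeNorm, Finset.sum_eq_zero_iff, funext_iff]

theorem leeNorm_add_le {d : ℕ} {n : Fin d → ℕ} (x y : Grid n) :
    leeNorm (x + y) ≤ leeNorm x + leeNorm y := by
  rw [leeNorm, leeNorm, leeNorm, ← Finset.sum_add_distrib]
  exact Finset.sum_le_sum fun i _ =>
    (ZMod.natAbs_valMinAbs_add_le _ _).trans (Int.natAbs_add_le _ _)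

theorem natAbs_valMinAbs_intCast_le {n : ℕ} [NeZero n] (y : ℤ) :
    (y : ZMod n).valMinAbs.natAbs ≤ y.natAbs :=
  ZMod.natAbs_min_of_le_div_two n _ _ (by simp) (ZMod.natAbs_valMinAbs_le _)

theorem leeNorm_single_le {d : ℕ} {n : Fin d → ℕ} [∀ i, NeZero (n i)] (i : Fin d) :
    leeNorm (Pi.single i 1 : Grid n) ≤ 1 := by
  rw [leeNorm, Finset.sum_eq_single i]
  · simpa using natAbs_valMinAbs_intCast_le (n := n i) 1
  · intro j _ hj
    simp [hj]
  · simp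

theorem leeNorm_sub_le_length {d : ℕ} {n : Fin d → ℕ} [∀ i, NeZero (n i)] {g h : Grid n}
    (p : (gridGraph n).Walk g h) : leeNorm (h - g) ≤ p.length := by
  induction p with
  | nil => simp [leeNorm_zero]
  | @cons a b c hab q ih =>
    have h1 : leeNorm (b - a) ≤ 1 := by
      rw [gridGraph, SimpleGraph.fromRel_adj] at hab
      rcases hab.2 with ⟨i, hi⟩ | ⟨i, hi⟩
      · rw [hi]; exact leeNorm_single_le i
      · rw [← leeNorm_neg, neg_sub, hi]; exact leeNorm_single_le i
    rw [SimpleGraph.Walk.length_cons, ← sub_add_sub_cancel c b a]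
    exact (leeNorm_add_le _ _).trans (Nat.add_le_add ih h1)

/-- Move a nonzero coordinate one step towards zero, as seen in its least absolute representative.
This drives the construction of short walks. -/
theorem exists_leeNorm_sub_lt {d : ℕ} {n : Fin d → ℕ} [∀ i, NeZero (n i)] {x : Grid n}
    (hx : x ≠ 0) :
    ∃ i : Fin d, ∃ y : Grid n, (y = Pi.single i 1 ∨ y = -Pi.single i 1) ∧
      leeNorm (x - y) < leeNorm x := by
  obtain ⟨i, hi⟩ := Function.ne_iff.1 hx
  have key : ∀ s : ℤ, ((x i).valMinAbs - s).natAbs < (x i).valMinAbs.natAbs →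
      leeNorm (x - Pi.single i (s : ZMod (n i))) < leeNorm x := by
    intro s hs
    have hle : ((x i) - (s : ZMod (n i))).valMinAbs.natAbs ≤ ((x i).valMinAbs - s).natAbs := by
      simpa using natAbs_valMinAbs_intCast_le (n := n i) ((x i).valMinAbs - s)
    refine Finset.sum_lt_sum (fun j _ => ?_) ⟨i, Finset.mem_univ i, ?_⟩
    · rcases eq_or_ne j i with rfl | hj
      · simpa using (hle.trans_lt hs).le
      · simp [hj]
    · simpa using hle.trans_lt hs
  have hv : (x i).valMinAbs ≠ 0 := by simpa using hi
  rcases lt_or_gt_of_ne hv with h | h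
  · refine ⟨i, _, Or.inr rfl, ?_⟩
    have := key (-1) (by omega)
    simpa [Pi.single_neg] using this
  · refine ⟨i, _, Or.inl rfl, ?_⟩
    have := key 1 (by omega)
    simpa using this

theorem exists_walk_length_le {d : ℕ} {n : Fin d → ℕ} [∀ i, NeZero (n i)] (m : ℕ)
    (g h : Grid n) (hm : leeNorm (h - g) ≤ m) :
    ∃ p : (gridGraph n).Walk g h, p.length ≤ m := by
  induction m generalizing g with
  | zero =>
    obtain rfl : h = g := sub_eq_zero.1 (leeNorm_eq_zero.1 (Nat.le_zero.1 hm))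
    exact ⟨.nil, by simp⟩
  | succ m ih =>
    rcases eq_or_ne (h - g) 0 with h0 | h0
    · obtain rfl : h = g := sub_eq_zero.1 h0
      exact ⟨.nil, by simp⟩
    obtain ⟨i, y, hy, hlt⟩ := exists_leeNorm_sub_lt h0
    obtain ⟨p, hp⟩ := ih (g + y) (by rw [← sub_sub]; omega)
    have hy0 : y ≠ 0 := by
      rintro rfl
      simp at hlt
    have hadj : (gridGraph n).Adj g (g + y) := by
      rw [gridGraph, SimpleGraph.fromRel_adj]
      refine ⟨by simpa using hy0, ?_⟩
      rcases hy with rfl | rfl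
      · exact Or.inl ⟨i, by simp⟩
      · exact Or.inr ⟨i, by simp⟩
    exact ⟨.cons hadj p, by simpa using hp⟩

theorem leeDist_eq {d : ℕ} (n : Fin d → ℕ) [∀ i, NeZero (n i)] (g h : Grid n) :
    leeDist n g h = leeNorm (g - h) := by
  rw [← leeNorm_neg, neg_sub]
  obtain ⟨p, hp⟩ := exists_walk_length_le _ g h le_rfl
  refine le_antisymm ((SimpleGraph.dist_le p).trans hp) ?_
  obtain ⟨q, hq⟩ := SimpleGraph.Reachable.exists_walk_length_eq_dist ⟨p⟩
  rw [leeDist, ← hq]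
  exact leeNorm_sub_le_length q

end ToricGrid

/-! ### Character sums on a single cycle -/

namespace ToricGrid

/-- The generating function of the absolute value on `ℤ/n`, twisted by a character. -/
noncomputable def leeSum {n : ℕ} [NeZero n] (χ : AddChar (ZMod n) ℂ) (r : ℝ) : ℂ :=
  ∑ j, χ j * (r : ℂ) ^ j.valMinAbs.natAbs

theorem addChar_zmod_apply {n : ℕ} [NeZero n] (χ : AddChar (ZMod n) ℂ) (j : ZMod n) :
    χ j = χ 1 ^ j.val := by
  rw [← AddChar.map_nsmul_eq_pow, nsmul_one, ZMod.natCast_zmod_val]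

theorem sum_zmod_eq_sum_range {n : ℕ} [NeZero n] (F : ℕ → ℂ) :
    ∑ j : ZMod n, F j.val = ∑ k ∈ Finset.range n, F k :=
  Finset.sum_nbij' ZMod.val Nat.cast
    (fun j _ => Finset.mem_range.2 j.val_lt) (fun _ _ => Finset.mem_univ _)
    (fun j _ => ZMod.natCast_zmod_val j)
    (fun _ hk => ZMod.val_cast_of_lt (Finset.mem_range.1 hk)) (fun _ _ => rfl)

/-- Cut the cycle at `m`: the first half is a geometric sum in `r * z`, and the reflected second
half, using `z ^ (2 * m) = 1`, is one in `r * z⁻¹`. -/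
theorem one_sub_mul_leeSum {m : ℕ} [NeZero (2 * m)] (χ : AddChar (ZMod (2 * m)) ℂ) (r : ℝ) :
    (1 - r * χ 1) * (1 - r * (χ 1)⁻¹) * leeSum χ r = (1 - r ^ 2) * (1 - χ 1 ^ m * r ^ m) := by
  have hz : χ 1 ^ (2 * m) = 1 := by
    rw [← AddChar.map_nsmul_eq_pow, nsmul_one, ZMod.natCast_self, AddChar.map_zero_eq_one]
  set z := χ 1 with hzdef
  have hz0 : z ≠ 0 := by
    intro h
    rw [h, zero_pow (NeZero.ne _)] at hz
    exact zero_ne_one hz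
  have hsum : leeSum χ r =
      ∑ k ∈ Finset.range (2 * m), z ^ k * (r : ℂ) ^ min k (2 * m - k) := by
    rw [← sum_zmod_eq_sum_range (n := 2 * m) fun k => z ^ k * (r : ℂ) ^ min k (2 * m - k)]
    refine Finset.sum_congr rfl fun j _ => ?_
    rw [addChar_zmod_apply, ZMod.valMinAbs_natAbs_eq_min]
  have h1 : ∑ k ∈ Finset.range m, z ^ k * (r : ℂ) ^ min k (2 * m - k) =
      ∑ k ∈ Finset.range m, (r * z) ^ k := by
    refine Finset.sum_congr rfl fun k hk => ?_
    have := Finset.mem_range.1 hk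
    rw [min_eq_left (by omega), mul_pow, mul_comm]
  have h2 : ∑ k ∈ Finset.range m, z ^ (m + k) * (r : ℂ) ^ min (m + k) (2 * m - (m + k)) =
      r * z⁻¹ * ∑ k ∈ Finset.range m, (r * z⁻¹) ^ k := by
    rw [← Finset.sum_range_reflect, Finset.mul_sum]
    refine Finset.sum_congr rfl fun k hk => ?_
    have := Finset.mem_range.1 hk
    rw [min_eq_right (by omega), ← pow_succ', mul_pow,
      (by omega : 2 * m - (m + (m - 1 - k)) = k + 1), mul_comm]
    congr 1
    rw [inv_pow]
    refine eq_inv_of_mul_eq_one_left ?_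
    rw [← pow_add, ← hz]
    congr 1
    omega
  have h3 : ((r : ℂ) * z⁻¹) ^ m = z ^ m * r ^ m := by
    rw [mul_pow, mul_comm]
    congr 1
    rw [inv_pow]
    refine inv_eq_of_mul_eq_one_left ?_
    rw [← pow_add, ← two_mul, hz]
  have hA := mul_neg_geom_sum ((r : ℂ) * z) m
  have hB := mul_neg_geom_sum ((r : ℂ) * z⁻¹) m
  rw [h3] at hB
  rw [mul_pow, mul_comm ((r : ℂ) ^ m)] at hA
  have hzz : z * z⁻¹ = 1 := mul_inv_cancel₀ hz0
  rw [hsum, two_mul, Finset.sum_range_add, ← two_mul, h1, h2]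
  generalize ∑ k ∈ Finset.range m, ((r : ℂ) * z) ^ k = A at *
  generalize ∑ k ∈ Finset.range m, ((r : ℂ) * z⁻¹) ^ k = B at *
  linear_combination (1 - r * z⁻¹) * hA + (1 - r * z) * r * z⁻¹ * hB -
    r ^ 2 * (1 - z ^ m * r ^ m) * hzz

theorem norm_addChar_apply {n : ℕ} [NeZero n] (χ : AddChar (ZMod n) ℂ) (j : ZMod n) :
    ‖χ j‖ = 1 :=
  AddChar.norm_apply χ j

theorem leeSum_im {n : ℕ} [NeZero n] (χ : AddChar (ZMod n) ℂ) (r : ℝ) :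
    (leeSum χ r).im = 0 := by
  rw [← Complex.conj_eq_iff_im, leeSum, map_sum]
  refine Fintype.sum_equiv (Equiv.neg _) _ _ fun j => ?_
  rw [Equiv.neg_apply, ZMod.natAbs_valMinAbs_neg, AddChar.map_neg_eq_conj]
  simp

theorem addChar_zmod_ext {n : ℕ} [NeZero n] {χ ψ : AddChar (ZMod n) ℂ} (h : χ 1 = ψ 1) :
    χ = ψ := by
  ext j
  rw [addChar_zmod_apply χ, addChar_zmod_apply ψ, h]

/-- On the unit circle the two denominators multiply to `|1 - rz|²`, and `z ^ m = ±1`. Evenness of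
`m` makes `z ^ m = 1` at `z = -1`, so the numerator is smallest there. -/
theorem normSq_mul_leeSum {m : ℕ} [NeZero (2 * m)] (hm : Even m)
    (χ : AddChar (ZMod (2 * m)) ℂ) {r : ℝ} (hr : r ∈ Set.Ioo (0 : ℝ) 1) :
    (1 - r ^ 2) * (1 - r ^ m) ≤ (1 - 2 * r * (χ 1).re + r ^ 2) * (leeSum χ r).re ∧
      (χ 1 = -1 → (1 - r ^ 2) * (1 - r ^ m) =
        (1 - 2 * r * (χ 1).re + r ^ 2) * (leeSum χ r).re) := by
  have h := one_sub_mul_leeSum χ r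
  have hz : χ 1 ^ (2 * m) = 1 := by
    rw [← AddChar.map_nsmul_eq_pow, nsmul_one, ZMod.natCast_self, AddChar.map_zero_eq_one]
  have hn := norm_addChar_apply χ 1
  have hr2 : 0 ≤ 1 - r ^ 2 := by nlinarith [hr.1, hr.2]
  set z := χ 1
  have hD : (1 - r * z) * (1 - r * z⁻¹) = ((1 - 2 * r * z.re + r ^ 2 : ℝ) : ℂ) := by
    have hns : z.re * z.re + z.im * z.im = 1 := by
      rw [← Complex.normSq_apply, Complex.normSq_eq_norm_sq, hn, one_pow]
    rw [Complex.inv_eq_conj hn]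
    apply Complex.ext
    · simp [pow_two]
      linear_combination r ^ 2 * hns
    · simp [pow_two]
      ring
  obtain ⟨ε, hε, hzε, hε'⟩ : ∃ ε : ℝ, ε ≤ 1 ∧ z ^ m = ε ∧ (z = -1 → ε = 1) := by
    have : z ^ m = 1 ∨ z ^ m = -1 := by
      rw [← sq_eq_one_iff, ← pow_mul, mul_comm, hz]
    rcases this with h | h
    · exact ⟨1, le_rfl, by simpa using h, fun _ => rfl⟩
    · refine ⟨-1, by norm_num, by simpa using h, fun h' => ?_⟩
      rw [h', hm.neg_one_pow] at h
      norm_num at h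
  have hre : (1 - 2 * r * z.re + r ^ 2) * (leeSum χ r).re = (1 - r ^ 2) * (1 - ε * r ^ m) := by
    rw [hD, hzε] at h
    have := congrArg Complex.re h
    rw [Complex.re_ofReal_mul] at this
    rw [this]
    norm_cast
  rw [hre]
  refine ⟨?_, fun h => by rw [hε' h, one_mul]⟩
  gcongr
  exact mul_le_of_le_one_left (pow_nonneg hr.1.le _) hε

/-- Strictness comes from the denominator, which reaches `(1 + r)²` only at `-1`. Positivity is
included so that factors can later be multiplied. -/
theorem leeSum_re_lt {n : ℕ} [NeZero n] (hn : n = 2 ∨ 4 ∣ n) {χ ψ : AddChar (ZMod n) ℂ}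
    (hψ : ψ 1 = -1) {r : ℝ} (hr : r ∈ Set.Ioo (0 : ℝ) 1) :
    0 < (leeSum ψ r).re ∧ (χ ≠ ψ → (leeSum ψ r).re < (leeSum χ r).re) := by
  rcases hn with rfl | ⟨l, rfl⟩
  · have hsum : ∀ φ : AddChar (ZMod 2) ℂ, leeSum φ r = 1 + φ 1 * r := by
      intro φ
      have h0 : ((0 : ZMod 2).valMinAbs.natAbs) = 0 := by decide
      have h1 : ((1 : ZMod 2).valMinAbs.natAbs) = 1 := by decide
      have : leeSum φ r = φ 0 * (r : ℂ) ^ (0 : ZMod 2).valMinAbs.natAbs +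
        φ 1 * (r : ℂ) ^ (1 : ZMod 2).valMinAbs.natAbs := Fin.sum_univ_two _
      rw [this, h0, h1, AddChar.map_zero_eq_one]
      simp
    rw [hsum, hsum, hψ]
    refine ⟨by simpa using hr.2, fun hne => ?_⟩
    have hsq : χ 1 = 1 ∨ χ 1 = -1 := by
      rw [← sq_eq_one_iff, ← AddChar.map_nsmul_eq_pow]
      exact AddChar.map_zero_eq_one χ
    rcases hsq with h | h
    · rw [h]
      simp
      linarith [hr.1]
    · exact absurd (addChar_zmod_ext (h.trans hψ.symm)) hne
  · obtain rfl | hl := Nat.eq_zero_or_pos l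
    · exact absurd rfl (NeZero.ne (4 * 0))
    obtain ⟨m, hm, hm2⟩ : ∃ m, 4 * l = 2 * m ∧ Even m := ⟨2 * l, by ring, even_two_mul l⟩
    have hm0 : m ≠ 0 := by omega
    revert χ ψ
    generalize hN : 4 * l = N at *
    subst hm
    intro χ ψ hψ
    have h1 := (normSq_mul_leeSum hm2 ψ hr).2 hψ
    have h2 := (normSq_mul_leeSum hm2 χ hr).1
    have hC : 0 < (1 - r ^ 2) * (1 - r ^ m) :=
      mul_pos (by nlinarith [hr.1, hr.2]) (sub_pos.2 (pow_lt_one₀ hr.1.le hr.2 hm0))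
    rw [hψ] at h1
    rw [h1] at h2 hC
    simp only [Complex.neg_re, Complex.one_re] at h1 h2 hC
    have hpos : 0 < (leeSum ψ r).re := pos_of_mul_pos_right hC (by nlinarith [hr.1])
    refine ⟨hpos, fun hne => ?_⟩
    have hz := norm_addChar_apply χ 1
    have hre : -1 < (χ 1).re := by
      have h3 := (abs_le.1 (Complex.abs_re_le_norm (χ 1))).1
      rw [hz] at h3
      refine lt_of_le_of_ne h3 fun h4 => hne (addChar_zmod_ext ?_)
      rw [hψ]
      have hns : (χ 1).re * (χ 1).re + (χ 1).im * (χ 1).im = 1 := by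
        rw [← Complex.normSq_apply, Complex.normSq_eq_norm_sq, hz, one_pow]
      rw [← h4] at hns
      have him : (χ 1).im = 0 := by nlinarith
      exact Complex.ext (by simp [← h4]) (by simp [him])
    by_contra! hle
    have hD : 0 < 1 - 2 * r * (χ 1).re + r ^ 2 := by
      have h3 := (abs_le.1 (Complex.abs_re_le_norm (χ 1))).2
      rw [hz] at h3
      nlinarith [hr.1, hr.2, sq_pos_of_pos (sub_pos.2 hr.2)]
    have h5 := mul_le_mul_of_nonneg_left hle hD.le
    have h6 : (1 - 2 * r * (χ 1).re + r ^ 2) * (leeSum ψ r).re <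
        (1 - 2 * r * -1 + r ^ 2) * (leeSum ψ r).re := by
      refine mul_lt_mul_of_pos_right ?_ hpos
      nlinarith [hr.1, mul_pos hr.1 (neg_lt_iff_pos_add.1 hre)]
    linarith

/-! ### Eigenvalues on the product group -/

section Product

variable {d : ℕ} {n : Fin d → ℕ} [∀ i, NeZero (n i)]

/-- The restriction of a character of `∏ ℤ/n_i` to a coordinate. -/
def component (χ : AddChar (Grid n) ℂ) (i : Fin d) : AddChar (ZMod (n i)) ℂ :=
  χ.compAddMonoidHom (AddMonoidHom.single (fun i => ZMod (n i)) i)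

theorem apply_eq_prod_component (χ : AddChar (Grid n) ℂ) (g : Grid n) :
    χ g = ∏ i, component χ i (g i) := by
  conv_lhs => rw [← Finset.univ_sum_single g]
  exact map_prod χ.toMonoidHom (fun i => Multiplicative.ofAdd (Pi.single i (g i))) Finset.univ

theorem sum_mul_pow_leeNorm (χ : AddChar (Grid n) ℂ) (r : ℝ) :
    ∑ g, χ g * (r : ℂ) ^ leeNorm g = ∏ i, leeSum (component χ i) r := by
  simp only [leeSum]
  rw [Finset.prod_univ_sum, Fintype.piFinset_univ]
  refine Finset.sum_congr rfl fun g _ => ?_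
  rw [apply_eq_prod_component, leeNorm, ← Finset.prod_pow_eq_pow_sum, ← Finset.prod_mul_distrib]

theorem sum_re_mul_pow_leeNorm (χ : AddChar (Grid n) ℂ) (r : ℝ) :
    ∑ g, (χ g).re * r ^ leeNorm g = ∏ i, (leeSum (component χ i) r).re := by
  have h1 : ∀ i, leeSum (component χ i) r = ((leeSum (component χ i) r).re : ℂ) := fun i =>
    Complex.ext rfl (by simp [leeSum_im])
  have h := congrArg Complex.re (sum_mul_pow_leeNorm χ r)
  rw [Finset.prod_congr rfl fun i _ => h1 i, ← Complex.ofReal_prod, Complex.ofReal_re,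
    Complex.re_sum] at h
  rw [← h]
  refine Finset.sum_congr rfl fun g _ => ?_
  rw [← Complex.ofReal_pow, Complex.re_mul_ofReal]

theorem sum_re_mul_pow_leeNorm_lt (hn : ∀ i, n i = 2 ∨ 4 ∣ n i) {χ ψ : AddChar (Grid n) ℂ}
    (hψ : ∀ i, ψ (Pi.single i 1) = -1) (hne : χ ≠ ψ) {r : ℝ} (hr : r ∈ Set.Ioo (0 : ℝ) 1) :
    ∑ g, (ψ g).re * r ^ leeNorm g < ∑ g, (χ g).re * r ^ leeNorm g := by
  rw [sum_re_mul_pow_leeNorm, sum_re_mul_pow_leeNorm]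
  have key := fun i => leeSum_re_lt (hn i) (χ := component χ i) (ψ := component ψ i) (hψ i) hr
  obtain ⟨i, hi⟩ : ∃ i, component χ i ≠ component ψ i := by
    by_contra! h
    refine hne (DFunLike.ext _ _ fun g => ?_)
    rw [apply_eq_prod_component, apply_eq_prod_component ψ]
    simp only [h]
  refine Finset.prod_lt_prod (fun i _ => (key i).1) (fun i _ => ?_) ⟨i, Finset.mem_univ i,
    (key i).2 hi⟩
  by_cases h : component χ i = component ψ i
  · rw [h]
  · exact ((key i).2 h).le

variable (n) in
theorem interaction_eq (f : ℝ → ℝ) (g h : Grid n) :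
    interaction n f g h = f (leeNorm (g - h)) := by
  rw [interaction, leeDist_eq]

theorem eigenvalue_re (f : ℝ → ℝ) (χ : AddChar (Grid n) ℂ) :
    (eigenvalue (interaction n f) χ).re =
      ∑ g ∈ Finset.univ.erase 0, (χ g).re * f (leeNorm g) := by
  rw [eigenvalue, Complex.re_sum]
  refine Finset.sum_congr rfl fun g _ => ?_
  rw [Complex.re_ofReal_mul, interaction_eq, sub_zero, mul_comm]

theorem eigenvalue_im (f : ℝ → ℝ) (χ : AddChar (Grid n) ℂ) :
    (eigenvalue (interaction n f) χ).im = 0 := by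
  rw [← Complex.conj_eq_iff_im, eigenvalue, map_sum]
  refine Finset.sum_nbij' (fun g => -g) (fun g => -g) ?_ ?_ ?_ ?_ ?_
  · simp
  · simp
  · simp
  · simp
  · intro g _
    rw [map_mul, Complex.conj_ofReal, AddChar.map_neg_eq_conj, interaction_eq, interaction_eq,
      sub_zero, sub_zero, leeNorm_neg]

theorem eigenvalue_re_lt (hn : ∀ i, n i = 2 ∨ 4 ∣ n i) {f : ℝ → ℝ}
    (hf : StrictlyCompletelyMonotonic f) {χ ψ : AddChar (Grid n) ℂ}
    (hψ : ∀ i, ψ (Pi.single i 1) = -1) (hne : χ ≠ ψ) :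
    (eigenvalue (interaction n f) ψ).re < (eigenvalue (interaction n f) χ).re := by
  rw [eigenvalue_re, eigenvalue_re, ← sub_pos, ← Finset.sum_sub_distrib]
  simp only [← sub_mul]
  refine hf.sum_pos _ (fun g => (χ g).re - (ψ g).re) leeNorm
    (fun g hg => leeNorm_eq_zero.not.2 (Finset.ne_of_mem_erase hg)) fun r hr => ?_
  have h := sub_pos.2 (sum_re_mul_pow_leeNorm_lt hn hψ hne hr)
  rw [← Finset.sum_sub_distrib] at h
  simp only [← sub_mul] at h
  -- The term `g = 0`, absent from the eigenvalue, cancels since both characters are `1` there.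
  rwa [Finset.sum_erase]
  simp

/-- The character that takes the value `-1` on each of the standard generators. -/
def signChar (hn : ∀ i, Even (n i)) : AddChar (Grid n) ℂ where
  toFun g := (-1) ^ ∑ i, (g i).val
  map_zero_eq_one' := by simp
  map_add_eq_mul' g h := by
    simp only [← Finset.prod_pow_eq_pow_sum, ← Finset.prod_mul_distrib]
    refine Finset.prod_congr rfl fun i _ => ?_
    rw [Pi.add_apply, ZMod.val_add, ← pow_add]
    -- Reduction modulo the even number `n i` does not change parity.
    conv_rhs => rw [← Nat.div_add_mod ((g i).val + (h i).val) (n i), pow_add, pow_mul,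
      (hn i).neg_one_pow, one_pow, one_mul]

theorem signChar_apply (hn : ∀ i, Even (n i)) (g : Grid n) :
    signChar hn g = (-1) ^ ∑ i, (g i).val := rfl

theorem signChar_single (hn : ∀ i, Even (n i)) (i : Fin d) :
    signChar hn (Pi.single i 1) = -1 := by
  have h1 : 1 < n i := by
    obtain ⟨k, hk⟩ := hn i
    have := NeZero.ne (n i)
    omega
  rw [signChar_apply, Finset.sum_eq_single i]
  · rw [Pi.single_eq_same, ZMod.val_one'' (by omega), pow_one]
  · intro j _ hj
    simp [hj]
  · simp

end Product

end ToricGrid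

namespace ToricGrid

/-! ### Plancherel and the spectral bound -/

section Fourier

variable {G : Type*} [AddCommGroup G] [Fintype G] [DecidableEq G]

/-- The Fourier coefficient of a real function at a character. -/
noncomputable def fourierCoeff (x : G → ℝ) (χ : AddChar G ℂ) : ℂ :=
  ∑ h, (x h : ℂ) * χ h

/-- Orthogonality of characters leaves only the terms with `k = h - g`. A point mass at `0` for `v`
gives Parseval; the punctured kernel gives the energy. -/
theorem sum_fourierCoeff_mul_normSq (v x : G → ℝ) :
    ∑ χ : AddChar G ℂ, (fourierCoeff v χ).re * Complex.normSq (fourierCoeff x χ) =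
      Fintype.card G * ∑ h, ∑ g, v g * (x h * x (h - g)) := by
  have h : ∑ χ : AddChar G ℂ, fourierCoeff v χ * (Complex.normSq (fourierCoeff x χ) : ℂ) =
      ((Fintype.card G * ∑ h, ∑ g, v g * (x h * x (h - g)) : ℝ) : ℂ) := by
    have h1 : ∀ χ : AddChar G ℂ, fourierCoeff v χ * (Complex.normSq (fourierCoeff x χ) : ℂ) =
        ∑ h, ∑ g, ∑ k, (v g * (x h * x k) : ℂ) * χ (k - (h - g)) := by
      intro χ
      rw [Complex.normSq_eq_conj_mul_self, fourierCoeff, fourierCoeff, map_sum, Finset.sum_mul_sum,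
        Finset.mul_sum]
      refine Finset.sum_congr rfl fun h _ => ?_
      rw [Finset.sum_mul_sum]
      refine Finset.sum_congr rfl fun g _ => Finset.sum_congr rfl fun k _ => ?_
      rw [map_mul, Complex.conj_ofReal, ← AddChar.map_neg_eq_conj,
        (by abel : k - (h - g) = g + (-h + k)), AddChar.map_add_eq_mul, AddChar.map_add_eq_mul]
      ring
    simp only [h1]
    rw [Finset.sum_comm]
    push_cast
    rw [Finset.mul_sum]
    refine Finset.sum_congr rfl fun h _ => ?_
    rw [Finset.sum_comm, Finset.mul_sum]
    refine Finset.sum_congr rfl fun g _ => ?_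
    rw [Finset.sum_comm]
    simp only [← Finset.mul_sum, AddChar.sum_apply_eq_ite, sub_eq_zero, mul_ite, mul_zero,
      Finset.sum_ite_eq', Finset.mem_univ, if_true]
    ring
  have h2 := congrArg Complex.re h
  rw [Complex.ofReal_re, Complex.re_sum] at h2
  simpa only [Complex.re_mul_ofReal] using h2

theorem sum_normSq_fourierCoeff (x : G → ℝ) :
    ∑ χ : AddChar G ℂ, Complex.normSq (fourierCoeff x χ) = Fintype.card G * (x ⬝ᵥ x) := by
  have h := sum_fourierCoeff_mul_normSq (Pi.single 0 1) x
  have h1 : ∀ χ : AddChar G ℂ, fourierCoeff (Pi.single 0 1) χ = 1 := by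
    intro χ
    rw [fourierCoeff, Finset.sum_eq_single 0] <;> simp +contextual
  simp only [h1, Complex.one_re, one_mul] at h
  rw [h, dotProduct]
  congr 1
  refine Finset.sum_congr rfl fun a _ => ?_
  rw [Finset.sum_eq_single 0] <;> simp +contextual

theorem sum_eigenvalue_mul_normSq (u : G → G → ℝ) (x : G → ℝ) :
    ∑ χ : AddChar G ℂ, (eigenvalue u χ).re * Complex.normSq (fourierCoeff x χ) =
      Fintype.card G * fractionalEnergy u x := by
  have h := sum_fourierCoeff_mul_normSq (fun g => if g = 0 then 0 else u g 0) x
  have herase : ∀ {M : Type} [AddCommMonoid M] (F : G → M),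
      ∑ g ∈ Finset.univ.erase 0, F g = ∑ g, if g = 0 then 0 else F g := by
    intro M _ F
    rw [← Finset.filter_ne', Finset.sum_filter]
    exact Finset.sum_congr rfl fun g _ => by split_ifs <;> simp_all
  have h1 : ∀ χ : AddChar G ℂ,
      fourierCoeff (fun g => if g = 0 then 0 else u g 0) χ = eigenvalue u χ := by
    intro χ
    rw [fourierCoeff, eigenvalue, herase]
    refine Finset.sum_congr rfl fun g _ => ?_
    split_ifs <;> simp
  simp only [h1] at h
  rw [h, fractionalEnergy, dotProduct]
  congr 1
  refine Finset.sum_congr rfl fun a _ => ?_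
  change _ = x a * ∑ g ∈ Finset.univ.erase 0, u g 0 * x (a - g)
  rw [herase, Finset.mul_sum]
  refine Finset.sum_congr rfl fun g _ => ?_
  split_ifs
  · simp
  · ring

theorem fourierCoeff_zero_right (x : G → ℝ) :
    fourierCoeff x 0 = ((x ⬝ᵥ 1 : ℝ) : ℂ) := by
  simp [fourierCoeff, dotProduct]

theorem eq_zero_of_fourierCoeff_eq_zero {x : G → ℝ} (h : ∀ χ, fourierCoeff x χ = 0) : x = 0 := by
  have h1 := sum_normSq_fourierCoeff x
  simp only [h, map_zero, Finset.sum_const_zero] at h1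
  have h2 : (Fintype.card G : ℝ) ≠ 0 := Nat.cast_ne_zero.2 Fintype.card_ne_zero
  exact dotProduct_self_eq_zero.1 ((mul_eq_zero.1 h1.symm).resolve_left h2)

variable (u : G → G → ℝ) (χ₀ : AddChar G ℂ) (σ : G → ℝ)

/-- The vectors allowed in the fractional energy problem. -/
def halfFilling (G : Type*) [Fintype G] : Set (G → ℝ) :=
  {x : G → ℝ | x ⬝ᵥ x = (Fintype.card G : ℝ) / 2 ∧ x ⬝ᵥ 1 = (Fintype.card G : ℝ) / 2}

/-- The minimal fractional energy in terms of the eigenvalues at `0` and at a character. -/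
noncomputable def spectralBound : ℝ :=
  ((eigenvalue u 0).re + (eigenvalue u χ₀).re) * (Fintype.card G / 4)

/-- Subtract the eigenvalue at `χ₀` times Parseval from the spectral expansion of the energy; the
constraints evaluate the trivial term and the total mass. -/
theorem card_mul_fractionalEnergy_sub {x : G → ℝ} (hx : x ∈ halfFilling G) :
    Fintype.card G * (fractionalEnergy u x - spectralBound u χ₀) =
      ∑ χ ∈ Finset.univ.erase (0 : AddChar G ℂ),
        ((eigenvalue u χ).re - (eigenvalue u χ₀).re) * Complex.normSq (fourierCoeff x χ) := by
  have h1 := sum_eigenvalue_mul_normSq u x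
  have h2 := sum_normSq_fourierCoeff x
  rw [← Finset.add_sum_erase _ _ (Finset.mem_univ (0 : AddChar G ℂ)), fourierCoeff_zero_right,
    hx.2, Complex.normSq_ofReal] at h1 h2
  rw [hx.1] at h2
  simp only [sub_mul, Finset.sum_sub_distrib, ← Finset.mul_sum]
  rw [spectralBound]
  linear_combination -h1 + (eigenvalue u χ₀).re * h2

variable {u χ₀ σ}

theorem sum_sign_eq_zero (h0 : χ₀ ≠ 0) (hσ : ∀ g, χ₀ g = σ g) : ∑ g, σ g = 0 := by
  have := AddChar.sum_eq_zero_iff_ne_zero.2 h0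
  simp only [hσ] at this
  exact_mod_cast this

theorem sum_apply_eq_zero {χ : AddChar G ℂ} (h : χ ≠ 0) : ∑ g, χ g = 0 :=
  AddChar.sum_eq_zero_iff_ne_zero.2 h

/-- Being `±1`-valued, `χ₀` is its own inverse, so its product with any other character is
nontrivial. -/
theorem sum_sign_mul_apply_eq_zero (hσ : ∀ g, χ₀ g = σ g) (hsq : ∀ g, σ g * σ g = 1)
    {χ : AddChar G ℂ} (h : χ ≠ χ₀) : ∑ g, (σ g : ℂ) * χ g = 0 := by
  have hne : χ₀ + χ ≠ 0 := by
    intro h'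
    refine h (DFunLike.ext _ _ fun g => ?_)
    have h1 : χ₀ g * χ g = 1 := by rw [← AddChar.add_apply, h', AddChar.zero_apply]
    have h2 : χ₀ g * χ₀ g = 1 := by rw [hσ]; exact_mod_cast hsq g
    exact mul_left_cancel₀ (left_ne_zero_of_mul_eq_one h1) (h1.trans h2.symm)
  have := AddChar.sum_eq_zero_iff_ne_zero.2 hne
  simpa only [AddChar.add_apply, hσ] using this

/-- The vectors `(1 ± σ) / 2` meet the constraints and the spectral bound. -/
theorem half_add_mem (h0 : χ₀ ≠ 0) (hσ : ∀ g, χ₀ g = σ g) (hsq : ∀ g, σ g * σ g = 1)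
    {c : ℝ} (hc : c * c = 1 / 4) : (fun g => 1 / 2 + c * σ g) ∈ halfFilling G := by
  have hs := sum_sign_eq_zero h0 hσ
  constructor
  · rw [dotProduct]
    have : ∀ g, (1 / 2 + c * σ g) * (1 / 2 + c * σ g) = 1 / 2 + c * σ g := by
      intro g
      linear_combination c * c * hsq g + hc
    simp only [this, Finset.sum_add_distrib, ← Finset.mul_sum, hs]
    simp
    ring
  · rw [dotProduct_one]
    simp only [Finset.sum_add_distrib, ← Finset.mul_sum, hs]
    simp
    ring

theorem fractionalEnergy_half_add (h0 : χ₀ ≠ 0) (hσ : ∀ g, χ₀ g = σ g)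
    (hsq : ∀ g, σ g * σ g = 1) {c : ℝ} (hc : c * c = 1 / 4) :
    fractionalEnergy u (fun g => 1 / 2 + c * σ g) = spectralBound u χ₀ := by
  have h := card_mul_fractionalEnergy_sub u χ₀ (half_add_mem h0 hσ hsq hc)
  rw [Finset.sum_eq_zero] at h
  · have h2 : (Fintype.card G : ℝ) ≠ 0 := Nat.cast_ne_zero.2 Fintype.card_ne_zero
    exact sub_eq_zero.1 ((mul_eq_zero.1 h).resolve_left h2)
  · intro χ hχ
    rcases eq_or_ne χ χ₀ with rfl | hne
    · simp
    have : fourierCoeff (fun g => 1 / 2 + c * σ g) χ = 0 := by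
      have h1 : ∀ g, ((1 / 2 + c * σ g : ℝ) : ℂ) * χ g =
          1 / 2 * χ g + c * ((σ g : ℂ) * χ g) := by
        intro g
        push_cast
        ring
      simp only [fourierCoeff, h1, Finset.sum_add_distrib, ← Finset.mul_sum,
        sum_apply_eq_zero (Finset.ne_of_mem_erase hχ), sum_sign_mul_apply_eq_zero hσ hsq hne]
      simp
    rw [this]
    simp

theorem spectralBound_le
    (hmin : ∀ χ : AddChar G ℂ, χ ≠ χ₀ → (eigenvalue u χ₀).re < (eigenvalue u χ).re)
    {x : G → ℝ} (hx : x ∈ halfFilling G) : spectralBound u χ₀ ≤ fractionalEnergy u x := by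
  have h := card_mul_fractionalEnergy_sub u χ₀ hx
  have h2 : (0 : ℝ) < Fintype.card G := Nat.cast_pos.2 Fintype.card_pos
  refine sub_nonneg.1 (nonneg_of_mul_nonneg_right (h.symm ▸ Finset.sum_nonneg fun χ _ => ?_) h2)
  refine mul_nonneg (sub_nonneg.2 ?_) (Complex.normSq_nonneg _)
  rcases eq_or_ne χ χ₀ with rfl | hne
  · exact le_rfl
  · exact (hmin χ hne).le

theorem eq_half_add_of_fractionalEnergy_eq (h0 : χ₀ ≠ 0) (hσ : ∀ g, χ₀ g = σ g)
    (hsq : ∀ g, σ g * σ g = 1)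
    (hmin : ∀ χ : AddChar G ℂ, χ ≠ χ₀ → (eigenvalue u χ₀).re < (eigenvalue u χ).re)
    {x : G → ℝ} (hx : x ∈ halfFilling G) (hE : fractionalEnergy u x = spectralBound u χ₀) :
    ∃ c : ℝ, c * c = 1 / 4 ∧ x = fun g => 1 / 2 + c * σ g := by
  have hK : (Fintype.card G : ℝ) ≠ 0 := Nat.cast_ne_zero.2 Fintype.card_ne_zero
  have hKC : (Fintype.card G : ℂ) ≠ 0 := Nat.cast_ne_zero.2 Fintype.card_ne_zero
  have h := card_mul_fractionalEnergy_sub u χ₀ hx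
  rw [hE, sub_self, mul_zero, eq_comm, Finset.sum_eq_zero_iff_of_nonneg] at h
  swap
  · intro χ _
    refine mul_nonneg (sub_nonneg.2 ?_) (Complex.normSq_nonneg _)
    rcases eq_or_ne χ χ₀ with rfl | hne
    · exact le_rfl
    · exact (hmin χ hne).le
  have hs := sum_sign_eq_zero h0 hσ
  -- This is the normalised coefficient at `χ₀`, the only one besides the trivial one that equality
  -- allows to be nonzero.
  set c : ℝ := (∑ g, x g * σ g) / Fintype.card G with hc
  have hx' : x = fun g => 1 / 2 + c * σ g := by
    have hz : (fun g => x g - (1 / 2 + c * σ g)) = 0 := by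
      refine eq_zero_of_fourierCoeff_eq_zero fun χ => ?_
      have h1 : ∀ g, ((x g - (1 / 2 + c * σ g) : ℝ) : ℂ) * χ g =
          x g * χ g - (1 / 2 * χ g + c * ((σ g : ℂ) * χ g)) := by
        intro g
        push_cast
        ring
      simp only [fourierCoeff, h1, Finset.sum_sub_distrib, Finset.sum_add_distrib,
        ← Finset.mul_sum]
      rw [← fourierCoeff]
      rcases eq_or_ne χ 0 with rfl | hχ0
      · have hs' : ∑ g, (σ g : ℂ) = 0 := by exact_mod_cast hs
        rw [fourierCoeff_zero_right, hx.2]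
        simp [hs']
        ring
      rcases eq_or_ne χ χ₀ with rfl | hχ
      · rw [sum_apply_eq_zero h0, fourierCoeff]
        simp only [hσ, ← Complex.ofReal_mul, hsq, ← Complex.ofReal_sum]
        rw [hc]
        simp
      · rw [sum_apply_eq_zero hχ0, sum_sign_mul_apply_eq_zero hσ hsq hχ]
        have := (mul_eq_zero.1 (h χ (Finset.mem_erase.2 ⟨hχ0, Finset.mem_univ _⟩))).resolve_left
          (sub_pos.2 (hmin χ hχ)).ne'
        rw [Complex.normSq_eq_zero.1 this]
        simp
    funext g
    exact sub_eq_zero.1 (congrFun hz g)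
  refine ⟨c, ?_, hx'⟩
  have h3 := hx.1
  rw [hx', dotProduct] at h3
  have : ∀ g, (1 / 2 + c * σ g) * (1 / 2 + c * σ g) = (1 / 4 + c * c) + c * σ g := by
    intro g
    linear_combination c * c * hsq g
  simp only [this, Finset.sum_add_distrib, ← Finset.mul_sum, hs] at h3
  simp only [Finset.sum_const, Finset.card_univ, nsmul_eq_mul, mul_zero, add_zero] at h3
  have h4 : (Fintype.card G : ℝ) * (c * c - 1 / 4) = 0 := by linear_combination h3
  linarith [(mul_eq_zero.1 h4).resolve_left hK]

end Fourier

/-! ### From vectors to subsets -/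

section Configurations

variable {G : Type*} [AddCommGroup G] [Fintype G] [DecidableEq G] {u : G → G → ℝ}
  {χ₀ : AddChar G ℂ} {E O : Finset G}

theorem charVec_injective : Function.Injective (charVec : Finset G → G → ℝ) := by
  intro S T h
  ext g
  have := congrFun h g
  by_cases h1 : g ∈ S <;> by_cases h2 : g ∈ T <;> simp_all [charVec]

theorem charVec_mem_halfFilling {S : Finset G} (hS : 2 * S.card = Fintype.card G) :
    charVec S ∈ halfFilling G := by
  have : (S.card : ℝ) = Fintype.card G / 2 := by
    rw [← hS]
    push_cast
    ring
  constructor <;> simp [charVec, dotProduct, this]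

theorem totalEnergy_eq_fractionalEnergy (hu : ∀ g h, u g h = u (g - h) 0) (S : Finset G) :
    totalEnergy u S = fractionalEnergy u (charVec S) := by
  have h1 : ∀ h, energyAt u S h =
      ∑ g ∈ Finset.univ.erase 0, u g 0 * charVec S (h - g) := by
    intro h
    have h2 : ∑ g ∈ Finset.univ.erase 0, u g 0 * charVec S (h - g) =
        ∑ g ∈ Finset.univ.erase h, u h g * charVec S g := by
      refine Finset.sum_nbij' (fun g => h - g) (fun g => h - g) ?_ ?_ ?_ ?_ ?_
      · simp
      · simp [sub_eq_zero, eq_comm]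
      · simp
      · simp
      · intro g _
        rw [hu h, sub_sub_cancel]
    rw [h2, energyAt]
    simp only [charVec, mul_ite, mul_one, mul_zero]
    rw [← Finset.sum_filter]
    congr 1
    ext g
    simp
  rw [totalEnergy, fractionalEnergy, dotProduct]
  simp only [charVec, ite_mul, one_mul, zero_mul, Finset.sum_ite_mem, Finset.univ_inter]
  exact Finset.sum_congr rfl fun h _ => h1 h

theorem energyAt_le_maxEnergy {S : Finset G} {h : G} (hS : h ∈ S) :
    energyAt u S h ≤ maxEnergy u S :=
  le_ciSup (f := fun h : {h : G // h ∈ S} => energyAt u S h.1) (Set.finite_range _).bddAbove ⟨h, hS⟩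

theorem totalEnergy_le_card_mul_maxEnergy (S : Finset G) :
    totalEnergy u S ≤ S.card * maxEnergy u S := by
  rw [← nsmul_eq_mul]
  exact Finset.sum_le_card_nsmul _ _ _ fun h hS => energyAt_le_maxEnergy hS

theorem totalEnergy_eq_card_mul_maxEnergy {S : Finset G} {e : ℝ} (hne : S.Nonempty)
    (he : ∀ h ∈ S, energyAt u S h = e) : totalEnergy u S = S.card * maxEnergy u S := by
  have : Nonempty {h : G // h ∈ S} := hne.to_subtype
  have h1 : maxEnergy u S = e := by
    rw [maxEnergy, ← ciSup_const (ι := {h : G // h ∈ S}) (a := e)]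
    exact iSup_congr fun h => he h.1 h.2
  rw [totalEnergy, Finset.sum_congr rfl he, h1, Finset.sum_const, nsmul_eq_mul]

/-- The map `g ↦ h - g` carries the fibre to the kernel of `χ₀`. The value does not depend on `h`,
so maximum and average agree on a fibre. -/
theorem energyAt_fiber (hu : ∀ g h, u g h = u (g - h) 0) {S : Finset G} {a : ℂ} (ha : a ≠ 0)
    (hS : ∀ g, g ∈ S ↔ χ₀ g = a) {h : G} (hh : h ∈ S) :
    energyAt u S h = ∑ g with χ₀ g = 1 ∧ g ≠ 0, u g 0 := by
  rw [hS] at hh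
  refine Finset.sum_nbij' (fun g => h - g) (fun g => h - g) ?_ ?_ ?_ ?_ ?_
  · intro g hg
    rw [Finset.mem_erase, hS] at hg
    simp only [Finset.mem_filter_univ]
    rw [AddChar.map_sub_eq_div, hh, hg.2, div_self ha, sub_ne_zero]
    exact ⟨rfl, hg.1.symm⟩
  · intro g hg
    simp only [Finset.mem_filter_univ] at hg
    rw [Finset.mem_erase, hS, AddChar.map_sub_eq_div, hh, hg.1, div_one]
    exact ⟨by simpa using hg.2, rfl⟩
  · simp
  · simp
  · intro g _
    exact hu h g

theorem charVec_fiber {S : Finset G} {c : ℝ} {σ : G → ℝ} (hσ : ∀ g, χ₀ g = σ g)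
    (hsq : ∀ g, σ g * σ g = 1) (hc : c * c = 1 / 4) (hS : ∀ g, g ∈ S ↔ χ₀ g = (2 * c : ℝ)) :
    charVec S = fun g => 1 / 2 + c * σ g := by
  funext g
  have h1 : g ∈ S ↔ σ g = 2 * c := by rw [hS, hσ, Complex.ofReal_inj]
  simp only [charVec, h1]
  split_ifs with h
  · rw [h]
    linarith
  · have : (σ g - 2 * c) * (σ g + 2 * c) = 0 := by linear_combination hsq g - 4 * hc
    rw [eq_neg_of_add_eq_zero_left ((mul_eq_zero.1 this).resolve_left (sub_ne_zero.2 h))]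
    linarith

/-- If the spectrum of a translation-invariant interaction is minimal exactly at a nontrivial
character `χ₀` with values `±1`, then the two fibres of `χ₀` are exactly the minimisers of the
fractional, total and maximal energies. -/
theorem minimisers_eq (hu : ∀ g h, u g h = u (g - h) 0) (h0 : χ₀ ≠ 0)
    (hE : ∀ g, g ∈ E ↔ χ₀ g = 1) (hO : ∀ g, g ∈ O ↔ χ₀ g = -1)
    (hEO : ∀ g, χ₀ g = 1 ∨ χ₀ g = -1)
    (hmin : ∀ χ : AddChar G ℂ, χ ≠ χ₀ → (eigenvalue u χ₀).re < (eigenvalue u χ).re) :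
    minimisers (fractionalEnergy u) (halfFilling G) = {charVec E, charVec O} ∧
    minimisers (totalEnergy u) {S : Finset G | 2 * S.card = Fintype.card G} = {E, O} ∧
    minimisers (maxEnergy u) {S : Finset G | 2 * S.card = Fintype.card G} = {E, O} := by
  set σ : G → ℝ := fun g => (χ₀ g).re with hσdef
  have hσ : ∀ g, χ₀ g = σ g := fun g => by
    rcases hEO g with h | h <;> simp [hσdef, h]
  have hsq : ∀ g, σ g * σ g = 1 := fun g => by
    rcases hEO g with h | h <;> simp [hσdef, h]
  have hcE : (1 / 2 : ℝ) * (1 / 2) = 1 / 4 := by norm_num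
  have hcO : (-1 / 2 : ℝ) * (-1 / 2) = 1 / 4 := by norm_num
  have hvE : charVec E = fun g => 1 / 2 + 1 / 2 * σ g :=
    charVec_fiber hσ hsq hcE (by simpa using hE)
  have hvO : charVec O = fun g => 1 / 2 + -1 / 2 * σ g :=
    charVec_fiber hσ hsq hcO (fun g => by rw [hO]; norm_num)
  have hmE : charVec E ∈ halfFilling G := hvE ▸ half_add_mem h0 hσ hsq hcE
  have hmO : charVec O ∈ halfFilling G := hvO ▸ half_add_mem h0 hσ hsq hcO
  have heE : fractionalEnergy u (charVec E) = spectralBound u χ₀ :=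
    hvE ▸ fractionalEnergy_half_add h0 hσ hsq hcE
  have heO : fractionalEnergy u (charVec O) = spectralBound u χ₀ :=
    hvO ▸ fractionalEnergy_half_add h0 hσ hsq hcO
  have hcard : ∀ S : Finset G, charVec S ∈ halfFilling G → 2 * S.card = Fintype.card G := by
    intro S hS
    have h1 : (S.card : ℝ) = Fintype.card G / 2 := by
      rw [← hS.2]
      simp [charVec, dotProduct]
    have : ((2 * S.card : ℕ) : ℝ) = Fintype.card G := by
      push_cast
      rw [h1]
      ring
    exact_mod_cast this
  have huniq : ∀ x ∈ halfFilling G, fractionalEnergy u x = spectralBound u χ₀ →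
      x = charVec E ∨ x = charVec O := by
    intro x hx hxe
    obtain ⟨c, hc, rfl⟩ := eq_half_add_of_fractionalEnergy_eq h0 hσ hsq hmin hx hxe
    have : (c - 1 / 2) * (c - -1 / 2) = 0 := by linear_combination hc
    rcases mul_eq_zero.1 this with h | h
    · left; rw [hvE, sub_eq_zero.1 h]
    · right; rw [hvO, sub_eq_zero.1 h]
  have huniqS : ∀ S : Finset G, 2 * S.card = Fintype.card G →
      totalEnergy u S = spectralBound u χ₀ → S = E ∨ S = O := by
    intro S hS hSe
    rw [totalEnergy_eq_fractionalEnergy hu] at hSe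
    exact (huniq _ (charVec_mem_halfFilling hS) hSe).imp (charVec_injective ·)
      (charVec_injective ·)
  have hle : ∀ S : Finset G, 2 * S.card = Fintype.card G →
      spectralBound u χ₀ ≤ totalEnergy u S := by
    intro S hS
    rw [totalEnergy_eq_fractionalEnergy hu]
    exact spectralBound_le hmin (charVec_mem_halfFilling hS)
  have hK : 0 < Fintype.card G := Fintype.card_pos
  have hfib : ∀ S : Finset G, S = E ∨ S = O → 2 * S.card = Fintype.card G ∧
      totalEnergy u S = spectralBound u χ₀ ∧ totalEnergy u S = S.card * maxEnergy u S := by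
    rintro S (rfl | rfl)
    · refine ⟨hcard _ hmE, (totalEnergy_eq_fractionalEnergy hu _).trans heE,
        totalEnergy_eq_card_mul_maxEnergy (Finset.card_pos.1 ?_)
          fun h hh => energyAt_fiber hu one_ne_zero hE hh⟩
      have := hcard _ hmE
      omega
    · refine ⟨hcard _ hmO, (totalEnergy_eq_fractionalEnergy hu _).trans heO,
        totalEnergy_eq_card_mul_maxEnergy (Finset.card_pos.1 ?_)
          fun h hh => energyAt_fiber hu (neg_ne_zero.2 one_ne_zero) hO hh⟩
      have := hcard _ hmO
      omega
  refine ⟨?_, ?_, ?_⟩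
  · ext x
    constructor
    · rintro ⟨hx, hxmin⟩
      exact huniq x hx (le_antisymm ((hxmin _ hmE).trans heE.le) (spectralBound_le hmin hx))
    · rintro (rfl | rfl)
      · exact ⟨hmE, fun y hy => heE.le.trans (spectralBound_le hmin hy)⟩
      · exact ⟨hmO, fun y hy => heO.le.trans (spectralBound_le hmin hy)⟩
  · ext S
    constructor
    · rintro ⟨hS, hSmin⟩
      obtain ⟨h1, h2, -⟩ := hfib E (Or.inl rfl)
      exact huniqS S hS (le_antisymm ((hSmin E h1).trans h2.le) (hle S hS))
    · intro hS
      obtain ⟨h1, h2, -⟩ := hfib S hS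
      exact ⟨h1, fun T hT => h2.le.trans (hle T hT)⟩
  · have hpos : ∀ {S : Finset G}, 2 * S.card = Fintype.card G → (0 : ℝ) < S.card := fun hS => by
      exact_mod_cast (by omega)
    have hcardeq : ∀ {S T : Finset G}, 2 * S.card = Fintype.card G →
        2 * T.card = Fintype.card G → S.card = T.card := fun hS hT => by omega
    ext S
    constructor
    · rintro ⟨hS, hSmin⟩
      obtain ⟨h1, h2, h3⟩ := hfib E (Or.inl rfl)
      refine huniqS S hS (le_antisymm ?_ (hle S hS))
      -- A minimiser of the maximum has total energy squeezed down to the spectral bound, so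
      -- uniqueness for the total energy applies.
      calc totalEnergy u S ≤ S.card * maxEnergy u S := totalEnergy_le_card_mul_maxEnergy S
        _ ≤ S.card * maxEnergy u E := mul_le_mul_of_nonneg_left (hSmin E h1) (Nat.cast_nonneg _)
        _ = spectralBound u χ₀ := by rw [hcardeq hS h1, ← h3, h2]
    · intro hS
      obtain ⟨h1, h2, h3⟩ := hfib S hS
      refine ⟨h1, fun T hT => le_of_mul_le_mul_left ?_ (hpos h1)⟩
      rw [← h3, h2, hcardeq h1 hT]
      exact (hle T hT).trans (totalEnergy_le_card_mul_maxEnergy T)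

end Configurations

end ToricGrid

theorem mainTheorem1 (d : ℕ) (hd : 0 < d) (n : Fin d → ℕ) [∀ i, NeZero (n i)]
    (hn : ∀ i, n i = 2 ∨ 4 ∣ n i) (f : ℝ → ℝ)
    (hf : ToricGrid.StrictlyCompletelyMonotonic f) :
    ToricGrid.minimisers (ToricGrid.fractionalEnergy (ToricGrid.interaction n f))
        {x : ToricGrid.Grid n → ℝ | x ⬝ᵥ x = (Fintype.card (ToricGrid.Grid n) : ℝ) / 2 ∧
          x ⬝ᵥ 1 = (Fintype.card (ToricGrid.Grid n) : ℝ) / 2} =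
      {ToricGrid.charVec (ToricGrid.evenBoard n), ToricGrid.charVec (ToricGrid.oddBoard n)} ∧
    ToricGrid.minimisers (ToricGrid.totalEnergy (ToricGrid.interaction n f))
        {S : Finset (ToricGrid.Grid n) | 2 * S.card = Fintype.card (ToricGrid.Grid n)} =
      {ToricGrid.evenBoard n, ToricGrid.oddBoard n} ∧
    ToricGrid.minimisers (ToricGrid.maxEnergy (ToricGrid.interaction n f))
        {S : Finset (ToricGrid.Grid n) | 2 * S.card = Fintype.card (ToricGrid.Grid n)} =
      {ToricGrid.evenBoard n, ToricGrid.oddBoard n} ∧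
    (∀ χ : AddChar (ToricGrid.Grid n) ℂ,
      (ToricGrid.eigenvalue (ToricGrid.interaction n f) χ).im = 0) ∧
    ∃ χ₀ : AddChar (ToricGrid.Grid n) ℂ, (∀ i, χ₀ (Pi.single i 1) = -1) ∧
      ∀ χ : AddChar (ToricGrid.Grid n) ℂ, χ ≠ χ₀ →
        (ToricGrid.eigenvalue (ToricGrid.interaction n f) χ₀).re <
          (ToricGrid.eigenvalue (ToricGrid.interaction n f) χ).re := by
  have heven : ∀ i, Even (n i) := fun i => by
    rcases hn i with h | ⟨k, h⟩
    · exact ⟨1, h⟩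
    · exact ⟨2 * k, by omega⟩
  have hsingle := ToricGrid.signChar_single heven
  have hmin : ∀ χ : AddChar (ToricGrid.Grid n) ℂ, χ ≠ ToricGrid.signChar heven →
      (ToricGrid.eigenvalue (ToricGrid.interaction n f) (ToricGrid.signChar heven)).re <
        (ToricGrid.eigenvalue (ToricGrid.interaction n f) χ).re :=
    fun χ hne => ToricGrid.eigenvalue_re_lt hn hf hsingle hne
  have h0 : ToricGrid.signChar heven ≠ 0 := by
    intro h
    -- Positive dimension supplies a generator on which the sign character is not `1`.
    have h1 := hsingle ⟨0, hd⟩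
    rw [h, AddChar.zero_apply] at h1
    norm_num at h1
  obtain ⟨h1, h2, h3⟩ := ToricGrid.minimisers_eq (u := ToricGrid.interaction n f)
    (E := ToricGrid.evenBoard n) (O := ToricGrid.oddBoard n)
    (fun g h => by rw [ToricGrid.interaction_eq, ToricGrid.interaction_eq, sub_zero]) h0
    (fun g => by
      rw [ToricGrid.evenBoard, Finset.mem_filter_univ, ToricGrid.signChar_apply,
        neg_one_pow_eq_one_iff_even (by norm_num)])
    (fun g => by
      rw [ToricGrid.oddBoard, Finset.mem_filter_univ, ToricGrid.signChar_apply,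
        neg_one_pow_eq_neg_one_iff_odd (by norm_num)])
    (fun g => neg_one_pow_eq_or ℂ _) hmin
  exact ⟨h1, h2, h3, ToricGrid.eigenvalue_im f, ToricGrid.signChar heven, hsingle, hmin⟩
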